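/- Let $x,y$ be indeterminates (or, more generally, arbitrary elements of a commutative ring). A three-step path is a lattice path consisting of up-steps $(1,1)$, level steps $(1,0)$ and down-steps $(1,-1)$, which have weights $1$, $x+y$ and $xy$, respectively; the weight of a path is the product of the weights of its steps. For non-negative integers $m,k,l$, let $\mathcal P^+_m(k,l)$ be the sum of the weights of all three-step paths from $(0,k)$ to $(m,l)$ that never run below the $x$-axis. Then, for all integers $n\ge 1$ and $k\ge 0$, $$\det_{0\le i,j\le n-1}\Bigl(\sum_{l\ge 0}\mathcal P^+_{i+j}(k,l)\Bigr)=\begin{cases}(-1)^{n_1\binom{k+1}{2}}(xy)^{(k+1)^2\binom{n_1+1}{2}-n},&\text{if } n=(k+1)n_1,\\ (-1)^{n_1\binom{k+1}{2}}(xy)^{(k+1)^2\binom{n_1+1}{2}},&\text{if } n=(k+1)n_1+1,\\ 0,&\text{if } n\not\equiv 0,1 \pmod{k+1},\end{cases}$$ where $n_1$ is an integer and where, if $k=0$, only the first line applies (so that the determinant is then $(xy)^{\binom n2}$). -/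

import Mathlib

/-- The three kinds of steps: up-step `(1,1)`, level step `(1,0)`, down-step `(1,-1)`. -/
inductive ThreeStep where
  | up
  | level
  | down
  deriving DecidableEq

namespace ThreeStep

instance : Fintype ThreeStep where
  elems := {up, level, down}
  complete s := by cases s <;> simp

/-- The change of height caused by a step. -/
def rise : ThreeStep → ℤ
  | up => 1
  | level => 0
  | down => -1

/-- The weight of a step: `1` for up, `x + y` for level, `x * y` for down. -/
def weight {R : Type*} [CommRing R] (x y : R) : ThreeStep → R
  | up => 1
  | level => x + y
  | down => x * y

/-- The height, after `m` steps, of the path starting at `(0, k)` whose successive steps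
are `p 0, …, p (n - 1)`. -/
def height {n : ℕ} (k : ℤ) (p : Fin n → ThreeStep) (m : ℕ) : ℤ :=
  k + ∑ i : Fin n with i.val < m, (p i).rise

/-- The three-step paths from `(0, k)` to `(n, l)` that never run below the `x`-axis,
each given by its sequence of steps. -/
def pathsPlus (n k l : ℕ) : Finset (Fin n → ThreeStep) :=
  Finset.univ.filter fun p : Fin n → ThreeStep =>
    (∀ m : Fin (n + 1), 0 ≤ height (k : ℤ) p m.val) ∧ height (k : ℤ) p n = (l : ℤ)

/-- The generating function `P⁺_n(k, l)`: the sum, over all three-step paths from `(0, k)` to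
`(n, l)` never running below the `x`-axis, of the product of the weights of the steps. -/
def genPlus {R : Type*} [CommRing R] (x y : R) (n k l : ℕ) : R :=
  ∑ p ∈ pathsPlus n k l, ∏ i, (p i).weight x y

/-- A path with `n` steps starting at height `k` ends at height at most `k + n`. -/
theorem genPlus_eq_zero {R : Type*} [CommRing R] (x y : R) (n k l : ℕ) (h : k + n < l) :
    genPlus x y n k l = 0 := by
  unfold genPlus
  apply Finset.sum_eq_zero
  intro p hp
  exfalso
  have h1 : height (k : ℤ) p n = (l : ℤ) := by
    unfold pathsPlus at hp
    exact (Finset.mem_filter.mp hp).2.2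
  have h2 : ∑ i : Fin n with i.val < n, (p i).rise ≤ n := by
    have h3 : ∀ s : ThreeStep, s.rise ≤ 1 := by
      intro s
      cases s <;> simp [rise]
    calc ∑ i : Fin n with i.val < n, (p i).rise
        ≤ ∑ i : Fin n with i.val < n, (1 : ℤ) := Finset.sum_le_sum fun i _ => h3 (p i)
      _ = n := by simp
  unfold height at h1
  omega

/-- The sum of `P⁺_n(k, l)` over all `l ≥ 0` has only finitely many non-zero terms, so that
the `finsum` below is the actual sum. -/
theorem finite_support_genPlus {R : Type*} [CommRing R] (x y : R) (n k : ℕ) :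
    (Function.support fun l : ℕ => genPlus x y n k l).Finite := by
  apply (Set.finite_Iic (k + n)).subset
  intro l hl
  by_contra h
  exact hl (genPlus_eq_zero x y n k l (not_le.mp h))

/-- The sum over all `l ≥ 0` of `P⁺_n(k, l)`: the generating function for all three-step paths
with `n` steps that start at height `k` and never run below the `x`-axis. -/
noncomputable def prefixGen {R : Type*} [CommRing R] (x y : R) (n k : ℕ) : R :=
  ∑ᶠ l : ℕ, genPlus x y n k l

end ThreeStep

/-! Write w = xy, and let L be the functional whose m-th moment is the path sum from height 0. Lucas
polynomials P obey in their index the recurrence that path sums obey in the starting height, so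
L(X^m P_{k+1}) is the path sum from height k. The determinant is thus the Hankel determinant of L
with weight d = P_{k+1}, monic of degree k.

The polynomials Q_m = P_{m+1} - P_m are orthogonal for L with norms w^m, because the axis is not
felt from high starts. Evaluating the functionals L(X^j ·), j < n, and the k remainder coefficients
modulo d on two monic bases gives a Christoffel-type formula (`neg_one_pow_mul_det_prefixGen`): up
to sign, the determinant is w^(n choose 2) times that of the remainders of Q_n, ..., Q_{n+k-1}
modulo d.

If k+1 divides z, then d divides P_z and P_{z+s} ≡ -w^s P_{z-s} (`dvd_lucasPoly_add_reflect`). The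
remainders are therefore periodic up to reflection and scaling, and the position of n modulo k+1
decides the value. -/

namespace ThreeStep

open Polynomial

variable {R : Type*} [CommRing R]

/-! ### Path sums and their recurrences -/

/-- The weights of all `n`-step paths starting at the integer height `k` that never run below
the `x`-axis, summed. -/
noncomputable def weightSum (x y : R) (n : ℕ) (k : ℤ) : R :=
  open Classical in
  ∑ p : Fin n → ThreeStep with ∀ m : Fin (n + 1), 0 ≤ height k p m.val, ∏ i, (p i).weight x y

theorem height_zero {n : ℕ} (k : ℤ) (p : Fin n → ThreeStep) : height k p 0 = k := by
  simp [height]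

theorem height_cons {n : ℕ} (k : ℤ) (s : ThreeStep) (p : Fin n → ThreeStep) (m : ℕ) :
    height k (Fin.cons s p : Fin (n + 1) → ThreeStep) (m + 1) = height (k + s.rise) p m := by
  simp [height, Finset.sum_filter, Fin.sum_univ_succ, add_assoc]

theorem prefixGen_eq_weightSum (x y : R) (n k : ℕ) :
    prefixGen x y n k = weightSum x y n k := by
  classical
  have hsub : (Function.support fun l : ℕ => genPlus x y n k l) ⊆
      (Finset.range (k + n + 1) : Finset ℕ) := by
    intro l hl
    by_contra h
    exact hl (genPlus_eq_zero x y n k l (by simpa [Nat.lt_succ_iff] using h))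
  rw [prefixGen, finsum_eq_sum_of_support_subset _ hsub, weightSum]
  unfold genPlus pathsPlus
  simp_rw [Finset.sum_filter]
  rw [Finset.sum_comm]
  refine Finset.sum_congr rfl fun p _ => ?_
  by_cases hp : ∀ m : Fin (n + 1), 0 ≤ height (k : ℤ) p m.val
  · obtain ⟨l, hl⟩ := Int.eq_ofNat_of_zero_le (hp (Fin.last n))
    rw [Fin.val_last] at hl
    have hle : l ≤ k + n := by
      have h3 : ∀ s : ThreeStep, s.rise ≤ 1 := by
        intro s
        cases s <;> simp [rise]
      have h2 : ∑ i : Fin n with i.val < n, (p i).rise ≤ n := by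
        calc ∑ i : Fin n with i.val < n, (p i).rise
            ≤ ∑ i : Fin n with i.val < n, (1 : ℤ) := Finset.sum_le_sum fun i _ => h3 (p i)
          _ = n := by simp
      unfold height at hl
      omega
    rw [Finset.sum_eq_single_of_mem l (by simpa [Nat.lt_succ_iff] using hle)]
    · rw [if_pos ⟨hp, hl⟩, if_pos hp]
    · intro b _ hb
      rw [if_neg]
      rintro ⟨-, h⟩
      exact hb (by rw [hl] at h; exact_mod_cast h.symm)
  · rw [if_neg hp]
    exact Finset.sum_eq_zero fun l _ => if_neg fun h => hp h.1

theorem weightSum_zero (x y : R) (k : ℕ) : weightSum x y 0 k = 1 := by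
  simp [weightSum, height]

theorem weightSum_of_neg (x y : R) (n : ℕ) {k : ℤ} (hk : k < 0) : weightSum x y n k = 0 := by
  rw [weightSum, Finset.filter_false_of_mem, Finset.sum_empty]
  intro p _ h
  have := h 0
  rw [Fin.val_zero, height_zero] at this
  omega

/-- Split off the first step. Integer heights avoid a boundary case: the term at height -1 vanishes
by `weightSum_of_neg`. -/
theorem weightSum_succ (x y : R) (n k : ℕ) :
    weightSum x y (n + 1) k = weightSum x y n (k + 1) + (x + y) * weightSum x y n k
      + x * y * weightSum x y n (k - 1) := by
  classical
  have key : ∀ (s : ThreeStep) (p : Fin n → ThreeStep),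
      (∀ m : Fin (n + 1 + 1),
        0 ≤ height (k : ℤ) (Fin.cons s p : Fin (n + 1) → ThreeStep) m.val) ↔
      ∀ m : Fin (n + 1), 0 ≤ height (k + s.rise) p m.val := by
    intro s p
    rw [Fin.forall_fin_succ]
    simp [height_zero, height_cons]
  have hsum : weightSum x y (n + 1) k
      = ∑ s : ThreeStep, s.weight x y * weightSum x y n (k + s.rise) := by
    unfold weightSum
    simp_rw [Finset.sum_filter, Finset.mul_sum]
    rw [← (Fin.consEquiv fun _ : Fin (n + 1) => ThreeStep).sum_comp, Fintype.sum_prod_type]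
    refine Finset.sum_congr rfl fun s _ => Finset.sum_congr rfl fun p _ => ?_
    have := key s p
    simp only [Fin.consEquiv, Equiv.coe_fn_mk, this, Fin.prod_univ_succ, Fin.cons_zero,
      Fin.cons_succ, mul_ite, mul_zero]
  rw [hsum]
  have huniv : (Finset.univ : Finset ThreeStep) = {up, level, down} := rfl
  rw [huniv, Finset.sum_insert (by simp), Finset.sum_insert (by simp), Finset.sum_singleton]
  simp [weight, rise, sub_eq_add_neg, add_assoc]

theorem prefixGen_zero (x y : R) (k : ℕ) : prefixGen x y 0 k = 1 := by
  rw [prefixGen_eq_weightSum, weightSum_zero]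

theorem prefixGen_succ_zero (x y : R) (n : ℕ) :
    prefixGen x y (n + 1) 0 = prefixGen x y n 1 + (x + y) * prefixGen x y n 0 := by
  simp only [prefixGen_eq_weightSum, weightSum_succ]
  rw [weightSum_of_neg x y n (k := ((0 : ℕ) : ℤ) - 1) (by simp)]
  simp

theorem prefixGen_succ_succ (x y : R) (n k : ℕ) :
    prefixGen x y (n + 1) (k + 1) = prefixGen x y n (k + 2)
      + (x + y) * prefixGen x y n (k + 1) + x * y * prefixGen x y n k := by
  simp only [prefixGen_eq_weightSum, weightSum_succ]
  rw [show (((k + 1 : ℕ) : ℤ) + 1) = ((k + 2 : ℕ) : ℤ) by push_cast; ring,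
    show (((k + 1 : ℕ) : ℤ) - 1) = (k : ℤ) by push_cast; ring]

/-- From height at least n, no n-step path can cross the axis, so the start is irrelevant. -/
theorem prefixGen_succ_right_of_le (x y : R) {n k : ℕ} (h : n ≤ k) :
    prefixGen x y n (k + 1) = prefixGen x y n k := by
  induction n generalizing k with
  | zero => simp [prefixGen_zero]
  | succ n ih =>
    obtain ⟨k, rfl⟩ : ∃ j, k = j + 1 := ⟨k - 1, by omega⟩
    rw [prefixGen_succ_succ, prefixGen_succ_succ, ih (show n ≤ k + 2 by omega),
      ih (show n ≤ k + 1 by omega), ih (show n ≤ k by omega)]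

/-- In n + 1 steps from height n only the all-down path crosses the axis; its weight is the
difference. -/
theorem prefixGen_diag (x y : R) (n : ℕ) :
    prefixGen x y (n + 1) (n + 1) = prefixGen x y (n + 1) n + (x * y) ^ (n + 1) := by
  induction n with
  | zero => simp [prefixGen_succ_succ, prefixGen_succ_zero, prefixGen_zero]
  | succ n ih =>
    rw [prefixGen_succ_succ x y (n + 1) (n + 1), prefixGen_succ_succ x y (n + 1) n,
      prefixGen_succ_right_of_le x y (show n + 1 ≤ n + 1 + 1 by omega),
      prefixGen_succ_right_of_le x y (show n + 1 ≤ n + 1 by omega), ih]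
    ring

/-! ### Lucas polynomials and divisibility -/

/-- The Lucas sequence of polynomials with `P 0 = 0`, `P 1 = 1` and
`P (m + 2) = (X - c) * P (m + 1) - w * P m`. -/
noncomputable def lucasPoly (c w : R) : ℕ → R[X]
  | 0 => 0
  | 1 => 1
  | m + 2 => (X - C c) * lucasPoly c w (m + 1) - C w * lucasPoly c w m

theorem lucasPoly_add_two (c w : R) (m : ℕ) :
    lucasPoly c w (m + 2) = (X - C c) * lucasPoly c w (m + 1) - C w * lucasPoly c w m := rfl

theorem natDegree_monic_lucasPoly [Nontrivial R] (c w : R) (m : ℕ) :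
    (lucasPoly c w (m + 1)).natDegree = m ∧ (lucasPoly c w (m + 1)).Monic := by
  induction m using Nat.twoStepInduction with
  | zero => simp [lucasPoly]
  | one => simp [lucasPoly, monic_X_sub_C]
  | more m ih₀ ih₁ =>
    rw [lucasPoly_add_two]
    have hmon : ((X - C c) * lucasPoly c w (m + 1 + 1)).Monic := (monic_X_sub_C c).mul ih₁.2
    have hdeg : ((X - C c) * lucasPoly c w (m + 1 + 1)).degree =
        ((m + 2 : ℕ) : WithBot ℕ) := by
      rw [degree_eq_natDegree hmon.ne_zero, (monic_X_sub_C c).natDegree_mul ih₁.2, ih₁.1,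
        natDegree_X_sub_C]
      norm_cast
      omega
    have hlt : (C w * lucasPoly c w (m + 1)).degree
        < ((X - C c) * lucasPoly c w (m + 1 + 1)).degree := by
      rw [hdeg]
      rw [C_mul']
      refine (degree_smul_le _ _).trans_lt (degree_le_natDegree.trans_lt ?_)
      rw [ih₀.1]
      norm_cast
      omega
    refine ⟨?_, hmon.sub_of_left hlt⟩
    rw [natDegree_eq_of_degree_eq (degree_sub_eq_left_of_degree_lt hlt),
      natDegree_eq_of_degree_eq_some hdeg]

/-- Modulo d the recurrence is run both ways from the zero at z; the powers of w replace the
division that the backward direction would need. -/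
theorem dvd_lucasPoly_add_reflect (c w : R) {d : R[X]} {z : ℕ} (hd : d ∣ lucasPoly c w z) (s : ℕ)
    (hs : s ≤ z) : d ∣ lucasPoly c w (z + s) + C w ^ s * lucasPoly c w (z - s) := by
  induction s using Nat.twoStepInduction with
  | zero =>
    simpa using dvd_add hd hd
  | one =>
    obtain ⟨z, rfl⟩ : ∃ j, z = j + 1 := ⟨z - 1, by omega⟩
    rw [Nat.add_assoc, lucasPoly_add_two]
    simpa using hd.mul_left _
  | more s ih₀ ih₁ =>
    obtain ⟨z, rfl⟩ : ∃ j, z = j + (s + 2) := ⟨z - (s + 2), by omega⟩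
    have h₀ := ih₀ (by omega)
    have h₁ := ih₁ (by omega)
    rw [show z + (s + 2) - s = z + 2 by omega, lucasPoly_add_two] at h₀
    rw [show z + (s + 2) - (s + 1) = z + 1 by omega,
      show z + (s + 2) + (s + 1) = z + (s + 2) + s + 1 by omega] at h₁
    rw [show z + (s + 2) - (s + 2) = z by omega,
      show z + (s + 2) + (s + 2) = z + (s + 2) + s + 2 by omega, lucasPoly_add_two]
    convert dvd_sub (h₁.mul_left (X - C c)) (h₀.mul_left (C w)) using 1
    ring

/-- Reflecting about m(a + 1) by m links the indices m(a + 2) and ma. -/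
theorem lucasPoly_dvd_mul (c w : R) (m a : ℕ) : lucasPoly c w m ∣ lucasPoly c w (m * a) := by
  induction a using Nat.twoStepInduction with
  | zero => simp [lucasPoly]
  | one => simp
  | more a ih₀ ih₁ =>
    have h := dvd_lucasPoly_add_reflect c w ih₁ m (by rw [mul_add]; omega)
    rw [show m * (a + 1) - m = m * a by rw [mul_add]; omega] at h
    exact (dvd_add_left (ih₀.mul_left _)).1 h

/-! ### Moments and orthogonality -/

/-- The linear functional on polynomials that maps `X ^ m` to `prefixGen x y m 0`. -/
noncomputable def momentMap (x y : R) : R[X] →ₗ[R] R :=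
  lsum fun m => LinearMap.mulRight R (prefixGen x y m 0)

theorem momentMap_X_pow (x y : R) (m : ℕ) : momentMap x y (X ^ m) = prefixGen x y m 0 := by
  simp [momentMap, ← monomial_one_right_eq_X_pow, sum_monomial_index]

/-- A factor X is one more step; the index shift makes P_0 = 0 match height -1. -/
theorem momentMap_X_pow_mul_lucasPoly (x y : R) (m k : ℕ) :
    momentMap x y (X ^ m * lucasPoly (x + y) (x * y) (k + 1)) = prefixGen x y m k := by
  induction k using Nat.twoStepInduction generalizing m with
  | zero => simp [lucasPoly, momentMap_X_pow]
  | one =>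
    have : X ^ m * lucasPoly (x + y) (x * y) (1 + 1) = X ^ (m + 1) - (x + y) • X ^ m := by
      simp only [lucasPoly, smul_eq_C_mul]
      ring
    rw [this, map_sub, map_smul, momentMap_X_pow, momentMap_X_pow, prefixGen_succ_zero, smul_eq_mul]
    ring
  | more k ih₀ ih₁ =>
    have : X ^ m * lucasPoly (x + y) (x * y) (k + 1 + 1 + 1)
        = X ^ (m + 1) * lucasPoly (x + y) (x * y) (k + 1 + 1)
          - (x + y) • (X ^ m * lucasPoly (x + y) (x * y) (k + 1 + 1))
          - (x * y) • (X ^ m * lucasPoly (x + y) (x * y) (k + 1)) := by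
      rw [lucasPoly_add_two]
      simp only [smul_eq_C_mul]
      ring
    rw [this, map_sub, map_sub, map_smul, map_smul, ih₀, ih₁, ih₁, prefixGen_succ_succ,
      smul_eq_mul, smul_eq_mul]
    ring

/-- The orthogonal polynomials for `momentMap`. -/
noncomputable def orthoPoly (c w : R) (m : ℕ) : R[X] :=
  lucasPoly c w (m + 1) - lucasPoly c w m

theorem natDegree_monic_orthoPoly [Nontrivial R] (c w : R) (m : ℕ) :
    (orthoPoly c w m).natDegree = m ∧ (orthoPoly c w m).Monic := by
  unfold orthoPoly
  rcases m with _ | m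
  · simp [lucasPoly]
  · obtain ⟨hd, hm⟩ := natDegree_monic_lucasPoly c w (m + 1)
    have hlt : (lucasPoly c w (m + 1)).degree < (lucasPoly c w (m + 1 + 1)).degree := by
      rw [degree_eq_natDegree hm.ne_zero, hd]
      refine degree_le_natDegree.trans_lt ?_
      rw [(natDegree_monic_lucasPoly c w m).1]
      norm_cast
      omega
    refine ⟨?_, hm.sub_of_left hlt⟩
    rw [natDegree_eq_of_degree_eq (degree_sub_eq_left_of_degree_lt hlt), hd]

/-- The value is a difference of path sums from adjacent heights, both at least i. -/
theorem momentMap_X_pow_mul_orthoPoly_of_lt (x y : R) {i m : ℕ} (h : i < m) :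
    momentMap x y (X ^ i * orthoPoly (x + y) (x * y) m) = 0 := by
  obtain ⟨m, rfl⟩ : ∃ j, m = j + 1 := ⟨m - 1, by omega⟩
  rw [orthoPoly, mul_sub, map_sub, momentMap_X_pow_mul_lucasPoly, momentMap_X_pow_mul_lucasPoly,
    prefixGen_succ_right_of_le x y (by omega), sub_self]

theorem momentMap_X_pow_mul_orthoPoly_self (x y : R) (m : ℕ) :
    momentMap x y (X ^ m * orthoPoly (x + y) (x * y) m) = (x * y) ^ m := by
  rcases m with _ | m
  · rw [orthoPoly, mul_sub, map_sub, momentMap_X_pow_mul_lucasPoly]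
    simp [lucasPoly, prefixGen_zero]
  · rw [orthoPoly, mul_sub, map_sub, momentMap_X_pow_mul_lucasPoly,
      momentMap_X_pow_mul_lucasPoly, prefixGen_diag]
    ring

/-! ### Change of basis and block signs -/

/-- The coefficient matrix of monic polynomials of degrees 0, 1, ... is unitriangular. -/
theorem det_apply_monic {ι : Type*} [Fintype ι] [DecidableEq ι] {N : ℕ} (e : ι ≃ Fin N)
    (φ : ι → R[X] →ₗ[R] R) (b : ℕ → R[X]) (hdeg : ∀ m, (b m).natDegree = m)
    (hmon : ∀ m, (b m).Monic) :
    (Matrix.of fun i j => φ j (b (e i))).det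
      = (Matrix.of fun i j => φ j (X ^ (e i : ℕ))).det := by
  have hfac : (Matrix.of fun i j => φ j (b (e i)))
      = ((Matrix.of fun i j : Fin N => (b j).coeff i).transpose.submatrix e e)
        * Matrix.of fun i j => φ j (X ^ (e i : ℕ)) := by
    ext i j
    rw [Matrix.mul_apply]
    simp only [Matrix.of_apply, Matrix.submatrix_apply, Matrix.transpose_apply]
    rw [e.sum_comp fun l : Fin N => (b (e i)).coeff l * φ j (X ^ (l : ℕ)),
      Fin.sum_univ_eq_sum_range (fun l => (b (e i)).coeff l * φ j (X ^ l)) N]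
    conv_lhs => rw [(b (e i)).as_sum_range' N (by rw [hdeg]; exact (e i).isLt), map_sum]
    refine Finset.sum_congr rfl fun l _ => ?_
    rw [← C_mul_X_pow_eq_monomial, C_mul', map_smul, smul_eq_mul]
  rw [hfac, Matrix.det_mul, Matrix.det_submatrix_equiv_self, Matrix.det_transpose,
    Matrix.det_matrixOfPolynomials (fun i : Fin N => b i) (fun i => hdeg i) (fun i => hmon i),
    one_mul]

theorem val_finRotate_pow_apply (N s : ℕ) (i : Fin N) :
    (((finRotate N) ^ s) i : ℕ) = (i + s) % N := by
  induction s with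
  | zero => simp [Nat.mod_eq_of_lt i.isLt]
  | succ s ih =>
    rcases N with _ | N
    · exact i.elim0
    · rw [pow_succ', Equiv.Perm.mul_apply, finRotate_apply, Fin.val_add, ih, ← add_assoc,
        Fin.val_one', Nat.add_mod_mod, Nat.mod_add_mod]

/-- The bijection identifying `Fin n ⊕ Fin k` with `Fin (n + k)` such that the right summand
comes first. -/
def sumFlipEquiv (n k : ℕ) : Fin n ⊕ Fin k ≃ Fin (n + k) :=
  ((Equiv.sumComm _ _).trans finSumFinEquiv).trans (finCongr (add_comm k n))

theorem sumFlipEquiv_inl {n k : ℕ} (i : Fin n) : (sumFlipEquiv n k (Sum.inl i) : ℕ) = k + i := by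
  simp [sumFlipEquiv, add_comm]

theorem sumFlipEquiv_inr {n k : ℕ} (j : Fin k) : (sumFlipEquiv n k (Sum.inr j) : ℕ) = j := by
  simp [sumFlipEquiv]

/-- On `Fin (n + k)` the block swap is the k-th power of the cyclic rotation. -/
theorem sign_sumFlipEquiv (n k : ℕ) :
    Equiv.Perm.sign ((sumFlipEquiv n k).trans finSumFinEquiv.symm) = (-1) ^ (n * k) := by
  rw [← Equiv.Perm.sign_symm_trans_trans _ (finSumFinEquiv (m := n) (n := k))]
  have h : (finSumFinEquiv.symm.trans ((sumFlipEquiv n k).trans finSumFinEquiv.symm)).trans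
      finSumFinEquiv = (finRotate (n + k)) ^ k := by
    ext i
    rw [val_finRotate_pow_apply]
    obtain ⟨i, rfl⟩ := finSumFinEquiv.surjective i
    rcases i with i | j
    · have := i.isLt
      simp only [Equiv.trans_apply, Equiv.symm_apply_apply, Equiv.apply_symm_apply]
      rw [sumFlipEquiv_inl, finSumFinEquiv_apply_left, Fin.val_castAdd, Nat.mod_eq_of_lt (by omega)]
      omega
    · have := j.isLt
      simp only [Equiv.trans_apply, Equiv.symm_apply_apply, Equiv.apply_symm_apply]
      rw [sumFlipEquiv_inr, finSumFinEquiv_apply_right, Fin.val_natAdd,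
        show n + (j : ℕ) + k = j + (n + k) by omega, Nat.add_mod_right,
        Nat.mod_eq_of_lt (by omega)]
  rw [h, map_pow, sign_finRotate, ← pow_mul]
  rcases k with _ | k
  · simp
  · rw [show (n + (k + 1) - 1) * (k + 1) = n * (k + 1) + k * (k + 1) by
      rw [show n + (k + 1) - 1 = n + k by omega]; ring, pow_add,
      (Nat.even_mul_succ_self k).neg_one_pow, mul_one]

/-! ### Reduction to remainders -/

/-- The coefficient of `X ^ j` in the remainder of a polynomial modulo `d`. -/
noncomputable def remCoeff (d : R[X]) (j : ℕ) : R[X] →ₗ[R] R :=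
  (lcoeff R j).comp (modByMonicHom d)

theorem remCoeff_apply (d : R[X]) (j : ℕ) (f : R[X]) : remCoeff d j f = (f %ₘ d).coeff j := rfl

theorem remCoeff_of_dvd {d : R[X]} (hd : d.Monic) (j : ℕ) {f : R[X]} (h : d ∣ f) :
    remCoeff d j f = 0 := by
  rw [remCoeff_apply, (modByMonic_eq_zero_iff_dvd hd).2 h, coeff_zero]

theorem remCoeff_of_natDegree_lt [Nontrivial R] {d : R[X]} (hd : d.Monic) (j : ℕ) {f : R[X]}
    (h : f.natDegree < d.natDegree) : remCoeff d j f = f.coeff j := by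
  rw [remCoeff_apply, (modByMonic_eq_self_iff hd).2 (degree_lt_degree h)]

/-- The Hankel determinant of the moments shifted by `lucasPoly (k + 1)`, expressed through
the remainders of the orthogonal polynomials modulo `lucasPoly (k + 1)`. -/
theorem neg_one_pow_mul_det_prefixGen [Nontrivial R] (x y : R) (n k : ℕ) :
    (-1) ^ (n * k) * (Matrix.of fun i j : Fin n => prefixGen x y (i.val + j.val) k).det
      = (x * y) ^ (n.choose 2) * (Matrix.of fun i j : Fin k =>
          remCoeff (lucasPoly (x + y) (x * y) (k + 1)) j
            (orthoPoly (x + y) (x * y) (n + i))).det := by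
  set d := lucasPoly (x + y) (x * y) (k + 1) with hd_def
  obtain ⟨hdeg, hd⟩ := natDegree_monic_lucasPoly (x + y) (x * y) k
  rw [← hd_def] at hdeg hd
  let φ : Fin n ⊕ Fin k → R[X] →ₗ[R] R := Sum.elim
    (fun j => (momentMap x y).comp (LinearMap.mulLeft R (X ^ (j : ℕ)))) (fun j => remCoeff d j)
  have hφl (j : Fin n) (f : R[X]) : φ (Sum.inl j) f = momentMap x y (X ^ (j : ℕ) * f) := rfl
  have hφr (j : Fin k) (f : R[X]) : φ (Sum.inr j) f = remCoeff d j f := rfl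
  -- This basis suits d: multiples of d have zero remainder, and lower powers of X are their own
  -- remainders.
  let b : ℕ → R[X] := fun m => if m < k then X ^ m else X ^ (m - k) * d
  have hb₁ : ∀ m, (b m).natDegree = m := by
    intro m
    by_cases h : m < k
    · simp [b, h]
    · simp only [b, h, if_false]
      rw [(monic_X_pow _).natDegree_mul hd, natDegree_X_pow, hdeg]
      omega
  have hb₂ : ∀ m, (b m).Monic := by
    intro m
    by_cases h : m < k
    · simp only [b, h, if_true]
      exact monic_X_pow _
    · simp only [b, h, if_false]
      exact (monic_X_pow _).mul hd
  have h₁ := det_apply_monic (sumFlipEquiv n k) φ b hb₁ hb₂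
  have h₂ := det_apply_monic finSumFinEquiv φ (orthoPoly (x + y) (x * y))
    (fun m => (natDegree_monic_orthoPoly _ _ m).1) (fun m => (natDegree_monic_orthoPoly _ _ m).2)
  have hperm : (Matrix.of fun i j => φ j (X ^ (sumFlipEquiv n k i : ℕ))).det
      = (-1) ^ (n * k) * (Matrix.of fun i j => φ j (X ^ (finSumFinEquiv i : ℕ))).det := by
    have := Matrix.det_permute ((sumFlipEquiv n k).trans finSumFinEquiv.symm)
      (Matrix.of fun i j => φ j (X ^ (finSumFinEquiv i : ℕ)))
    rw [sign_sumFlipEquiv] at this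
    rw [← show (((((-1) ^ (n * k) : ℤˣ) : ℤ)) : R) = (-1) ^ (n * k) by push_cast; rfl, ← this]
    congr 1
    ext i j
    simp
  have hH : (Matrix.of fun i j => φ j (b (sumFlipEquiv n k i)))
      = Matrix.fromBlocks (Matrix.of fun i j : Fin n => prefixGen x y (i.val + j.val) k) 0
        (Matrix.of fun (i : Fin k) (j : Fin n) => φ (Sum.inl j) (b i)) 1 := by
    ext i j
    rcases i with i | i <;> rcases j with j | j
    · simp only [Matrix.of_apply, Matrix.fromBlocks_apply₁₁, sumFlipEquiv_inl, hφl, b]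
      rw [if_neg (by omega), Nat.add_sub_cancel_left, ← mul_assoc, ← pow_add,
        momentMap_X_pow_mul_lucasPoly, add_comm]
    · simp only [Matrix.of_apply, Matrix.fromBlocks_apply₁₂, sumFlipEquiv_inl, hφr, b]
      rw [if_neg (by omega), remCoeff_of_dvd hd _ (dvd_mul_left _ _)]
      rfl
    · simp only [Matrix.of_apply, Matrix.fromBlocks_apply₂₁, sumFlipEquiv_inr]
    · simp only [Matrix.of_apply, Matrix.fromBlocks_apply₂₂, sumFlipEquiv_inr, hφr, b]
      rw [if_pos i.isLt, remCoeff_of_natDegree_lt hd _ (by rw [natDegree_X_pow, hdeg]; exact i.isLt),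
        coeff_X_pow, Matrix.one_apply]
      simp only [Fin.ext_iff, eq_comm]
  -- Orthogonality kills the lower left block, as n + i exceeds every j < n.
  have hQ : (Matrix.of fun i j => φ j (orthoPoly (x + y) (x * y) (finSumFinEquiv i)))
      = Matrix.fromBlocks
        (Matrix.of fun i j : Fin n => φ (Sum.inl j) (orthoPoly (x + y) (x * y) i))
        (Matrix.of fun (i : Fin n) (j : Fin k) => φ (Sum.inr j) (orthoPoly (x + y) (x * y) i)) 0
        (Matrix.of fun i j : Fin k => remCoeff d j (orthoPoly (x + y) (x * y) (n + i))) := by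
    ext i j
    rcases i with i | i <;> rcases j with j | j
    · simp
    · simp
    · simp only [Matrix.of_apply, Matrix.fromBlocks_apply₂₁, finSumFinEquiv_apply_right,
        Fin.val_natAdd, hφl]
      rw [momentMap_X_pow_mul_orthoPoly_of_lt x y (by omega)]
      rfl
    · simp [hφr]
  have hT : (Matrix.of fun i j : Fin n => φ (Sum.inl j) (orthoPoly (x + y) (x * y) i)).det
      = (x * y) ^ (n.choose 2) := by
    rw [Matrix.det_of_isUpperTriangular]
    · simp only [Matrix.of_apply, hφl, momentMap_X_pow_mul_orthoPoly_self]
      rw [Finset.prod_pow_eq_pow_sum, Fin.sum_univ_eq_sum_range (fun i => i) n,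
        Finset.sum_range_id, Nat.choose_two_right]
    · intro i j hij
      exact momentMap_X_pow_mul_orthoPoly_of_lt x y hij
  rw [hperm, ← h₂, hH, hQ, Matrix.det_fromBlocks_zero₁₂, Matrix.det_fromBlocks_zero₂₁, hT,
    Matrix.det_one, mul_one] at h₁
  rw [h₁, ← mul_assoc, ← mul_pow, neg_one_mul, neg_neg, one_pow, one_mul]

/-! ### Determinants of remainders -/

theorem det_antidiagonal (n : ℕ) :
    (Matrix.of fun i j : Fin n => if i.val + j.val + 1 = n then (1 : R) else 0).det
      = (-1) ^ (n.choose 2) := by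
  induction n with
  | zero => simp
  | succ n ih =>
    rw [Matrix.det_succ_row_zero, Finset.sum_eq_single (Fin.last n)]
    · have hsub : (Matrix.of fun i j : Fin (n + 1) =>
          if i.val + j.val + 1 = n + 1 then (1 : R) else 0).submatrix Fin.succ
            (Fin.last n).succAbove
          = Matrix.of fun i j : Fin n => if i.val + j.val + 1 = n then (1 : R) else 0 := by
        ext i j
        simp only [Matrix.submatrix_apply, Matrix.of_apply, Fin.succAbove_last, Fin.val_succ,
          Fin.val_castSucc]
        congr 1
        exact propext ⟨fun h => by omega, fun h => by omega⟩
      rw [hsub, ih]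
      simp only [Matrix.of_apply, Fin.val_zero, Fin.val_last, zero_add, if_true, mul_one]
      rw [← pow_add, Nat.choose_succ_succ' n 1, Nat.choose_one_right]
    · intro j _ hj
      have : (j : ℕ) ≠ n := fun h => hj (Fin.ext h)
      simp [this]
    · simp

theorem det_submatrix_rev {n : ℕ} (A : Matrix (Fin n) (Fin n) R) :
    (A.submatrix Fin.rev id).det = (-1) ^ (n.choose 2) * A.det := by
  rw [← det_antidiagonal, ← Matrix.det_mul]
  congr 1
  ext i j
  rw [Matrix.mul_apply, Finset.sum_eq_single (Fin.rev i)]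
  · have : (i : ℕ) + (n - (i + 1)) + 1 = n := by omega
    simp [Fin.val_rev, this]
  · intro l _ hl
    have : (i : ℕ) + l + 1 ≠ n := fun h => hl (Fin.ext (by rw [Fin.val_rev]; omega))
    simp [this]
  · simp

theorem remCoeff_lucasPoly_reflect [Nontrivial R] (c w : R) (k a s j : ℕ)
    (hs : s ≤ (k + 1) * a) :
    remCoeff (lucasPoly c w (k + 1)) j (lucasPoly c w ((k + 1) * a + s))
      = -w ^ s * remCoeff (lucasPoly c w (k + 1)) j (lucasPoly c w ((k + 1) * a - s)) := by
  have h := remCoeff_of_dvd (natDegree_monic_lucasPoly c w k).2 j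
    (dvd_lucasPoly_add_reflect c w (lucasPoly_dvd_mul c w (k + 1) a) s hs)
  rw [map_add, ← C_pow, C_mul', map_smul, smul_eq_mul] at h
  linear_combination h

theorem remCoeff_lucasPoly_mul [Nontrivial R] (c w : R) (k a j : ℕ) :
    remCoeff (lucasPoly c w (k + 1)) j (lucasPoly c w ((k + 1) * a)) = 0 :=
  remCoeff_of_dvd (natDegree_monic_lucasPoly c w k).2 j (lucasPoly_dvd_mul c w (k + 1) a)

/-- For a = 0 nothing is reduced and the matrix is unitriangular. Reflection about (k + 1)(a + 1)
reverses the rows and scales the new row i by -w^(i+1). -/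
theorem det_remCoeff_lucasPoly [Nontrivial R] (c w : R) (k a : ℕ) :
    (Matrix.of fun i j : Fin k => remCoeff (lucasPoly c w (k + 1)) j
      (lucasPoly c w ((k + 1) * a + 1 + i))).det
      = (-1) ^ (a * (k + 1).choose 2) * w ^ (a * (k + 1).choose 2) := by
  induction a with
  | zero =>
    have : (Matrix.of fun i j : Fin k => remCoeff (lucasPoly c w (k + 1)) j
        (lucasPoly c w ((k + 1) * 0 + 1 + i)))
        = (Matrix.of fun i j : Fin k => (lucasPoly c w (j + 1)).coeff i).transpose := by
      ext i j
      simp only [Matrix.of_apply, Matrix.transpose_apply, mul_zero, zero_add]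
      rw [add_comm 1, remCoeff_of_natDegree_lt (natDegree_monic_lucasPoly c w k).2]
      rw [(natDegree_monic_lucasPoly c w k).1, (natDegree_monic_lucasPoly c w i).1]
      exact i.isLt
    rw [this, Matrix.det_transpose, Matrix.det_matrixOfPolynomials
      (fun i : Fin k => lucasPoly c w (i + 1)) (fun i => (natDegree_monic_lucasPoly c w i).1)
      (fun i => (natDegree_monic_lucasPoly c w i).2)]
    simp
  | succ a ih =>
    set A := Matrix.of fun i j : Fin k => remCoeff (lucasPoly c w (k + 1)) j
      (lucasPoly c w ((k + 1) * a + 1 + i)) with hA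
    have : (Matrix.of fun i j : Fin k => remCoeff (lucasPoly c w (k + 1)) j
        (lucasPoly c w ((k + 1) * (a + 1) + 1 + i)))
        = Matrix.of fun (i j : Fin k) => (-w ^ ((i : ℕ) + 1)) * (A.submatrix Fin.rev id) i j := by
      ext i j
      have hi := i.isLt
      have hz : (k + 1) * (a + 1) = (k + 1) * a + (k + 1) := by ring
      simp only [Matrix.of_apply, Matrix.submatrix_apply, hA, id]
      rw [add_assoc, add_comm 1, remCoeff_lucasPoly_reflect c w k (a + 1) _ _ (by omega),
        Fin.val_rev, hz, show (k + 1) * a + (k + 1) - ((i : ℕ) + 1)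
          = (k + 1) * a + 1 + (k - (i + 1)) by omega]
    have hexp : ∑ i : Fin k, ((i : ℕ) + 1) = (k + 1).choose 2 := by
      rw [Fin.sum_univ_eq_sum_range (fun i => i + 1) k, Finset.sum_add_distrib,
        Finset.sum_range_id, Nat.choose_succ_succ' k 1, Nat.choose_one_right,
        Nat.choose_two_right]
      simp [add_comm]
    have hprod : ∏ i : Fin k, (-w ^ ((i : ℕ) + 1)) = (-1) ^ k * w ^ ((k + 1).choose 2) := by
      rw [← hexp, ← Finset.prod_pow_eq_pow_sum, Finset.prod_neg, Finset.card_univ, Fintype.card_fin]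
    rw [this, Matrix.det_mul_column, det_submatrix_rev, ih, hprod, Nat.add_mul, one_mul, pow_add,
      pow_add w, show (-1 : R) ^ ((k + 1).choose 2) = (-1) ^ k * (-1) ^ (k.choose 2) by
        rw [Nat.choose_succ_succ' k 1, Nat.choose_one_right, pow_add]]
    ring

/-- With z = (k + 1)a, P_z ≡ 0 gives Q_z ≡ P_{z+1}; later rows are successive differences, undone by
row operations. -/
theorem det_remCoeff_orthoPoly_mul [Nontrivial R] (c w : R) (k a : ℕ) :
    (Matrix.of fun i j : Fin k => remCoeff (lucasPoly c w (k + 1)) j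
      (orthoPoly c w ((k + 1) * a + i))).det
      = (-1) ^ (a * (k + 1).choose 2) * w ^ (a * (k + 1).choose 2) := by
  rw [← det_remCoeff_lucasPoly c w k a]
  rcases k with _ | k
  · simp
  refine (Matrix.det_eq_of_forall_row_eq_smul_add_pred (fun _ => 1) (fun j => ?_) (fun i j => ?_)).symm
  · simp [orthoPoly, remCoeff_lucasPoly_mul]
  · simp only [orthoPoly, Matrix.of_apply, map_sub, Fin.val_succ, Fin.val_castSucc]
    rw [show (k + 1 + 1) * a + ((i : ℕ) + 1) + 1 = (k + 1 + 1) * a + 1 + (i + 1) by ring,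
      show (k + 1 + 1) * a + ((i : ℕ) + 1) = (k + 1 + 1) * a + 1 + i by ring]
    ring

/-- Now all rows are differences, and the last involves P at (k + 1)(a + 1), which is ≡ 0. So an
upper bidiagonal factor with diagonal -1 splits off. -/
theorem det_remCoeff_orthoPoly_mul_add_one [Nontrivial R] (c w : R) (k a : ℕ) :
    (Matrix.of fun i j : Fin k => remCoeff (lucasPoly c w (k + 1)) j
      (orthoPoly c w ((k + 1) * a + 1 + i))).det
      = (-1) ^ k * ((-1) ^ (a * (k + 1).choose 2) * w ^ (a * (k + 1).choose 2)) := by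
  rw [← det_remCoeff_lucasPoly c w k a]
  set A := Matrix.of fun i j : Fin k => remCoeff (lucasPoly c w (k + 1)) j
      (lucasPoly c w ((k + 1) * a + 1 + i)) with hA
  set U : Matrix (Fin k) (Fin k) R := Matrix.of fun i j =>
    (if j.val = i.val + 1 then 1 else 0) - (if j = i then 1 else 0) with hU
  have hdet : U.det = (-1) ^ k := by
    rw [Matrix.det_of_isUpperTriangular]
    · simp [hU]
    · intro i j hij
      have h₁ : (j : ℕ) < i := hij
      simp only [hU, Matrix.of_apply]
      rw [if_neg (by omega), if_neg (by rw [Fin.ext_iff]; omega), sub_self]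
  rw [← hdet, ← Matrix.det_mul]
  congr 1
  ext i j
  simp only [Matrix.mul_apply, hU, Matrix.of_apply, sub_mul, Finset.sum_sub_distrib, ite_mul,
    one_mul, zero_mul, Finset.sum_ite_eq', Finset.mem_univ, if_true, orthoPoly, map_sub, hA]
  congr 1
  by_cases h : (i : ℕ) + 1 < k
  · rw [Finset.sum_eq_single ⟨i + 1, h⟩]
    · simp [add_assoc]
    · intro l _ hl
      exact if_neg fun h' => hl (Fin.ext h')
    · simp
  · rw [Finset.sum_eq_zero fun l _ => if_neg (by omega),
      show (k + 1) * a + 1 + (i : ℕ) + 1 = (k + 1) * (a + 1) by rw [mul_add]; omega,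
      remCoeff_lucasPoly_mul]

/-- With z = (k + 1)(a + 1), both Q_{z-1} ≡ -P_{z-1} and Q_z ≡ P_{z+1} ≡ -w P_{z-1} occur among the
rows, hence two rows are proportional. -/
theorem det_remCoeff_orthoPoly_eq_zero [Nontrivial R] (c w : R) (k a r : ℕ) (hr : 2 ≤ r)
    (hrk : r ≤ k) :
    (Matrix.of fun i j : Fin k => remCoeff (lucasPoly c w (k + 1)) j
      (orthoPoly c w ((k + 1) * a + r + i))).det = 0 := by
  set A := Matrix.of fun i j : Fin k => remCoeff (lucasPoly c w (k + 1)) j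
      (orthoPoly c w ((k + 1) * a + r + i)) with hA
  have hz : (k + 1) * (a + 1) = (k + 1) * a + (k + 1) := by ring
  let i₀ : Fin k := ⟨k - r, by omega⟩
  let i₁ : Fin k := ⟨k - r + 1, by omega⟩
  have hne : i₀ ≠ i₁ := by simp [i₀, i₁, Fin.ext_iff]
  have hrow : A i₁ = w • A i₀ := by
    ext j
    simp only [hA, Matrix.of_apply, i₀, i₁, Pi.smul_apply, smul_eq_mul, orthoPoly, map_sub]
    rw [show (k + 1) * a + r + (k - r + 1) + 1 = (k + 1) * (a + 1) + 1 by omega,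
      show (k + 1) * a + r + (k - r + 1) = (k + 1) * (a + 1) by omega,
      show (k + 1) * a + r + (k - r) + 1 = (k + 1) * (a + 1) by omega,
      show (k + 1) * a + r + (k - r) = (k + 1) * (a + 1) - 1 by omega,
      remCoeff_lucasPoly_reflect c w k (a + 1) 1 _ (by omega), remCoeff_lucasPoly_mul]
    ring
  rw [← Matrix.updateRow_eq_self A i₁, hrow, Matrix.det_updateRow_smul,
    Matrix.det_updateRow_eq_zero hne, mul_zero]

end ThreeStep

/-! ### The three residue cases -/

theorem theorem3 {R : Type*} [CommRing R] (x y : R) (n k : ℕ) (hn : 1 ≤ n) :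
    (∀ n₁ : ℕ, n = (k + 1) * n₁ →
      (Matrix.of fun i j : Fin n => ThreeStep.prefixGen x y (i.val + j.val) k).det =
        (-1) ^ (n₁ * (k + 1).choose 2) * (x * y) ^ ((k + 1) ^ 2 * (n₁ + 1).choose 2 - n)) ∧
    (1 ≤ k → ∀ n₁ : ℕ, n = (k + 1) * n₁ + 1 →
      (Matrix.of fun i j : Fin n => ThreeStep.prefixGen x y (i.val + j.val) k).det =
        (-1) ^ (n₁ * (k + 1).choose 2) * (x * y) ^ ((k + 1) ^ 2 * (n₁ + 1).choose 2)) ∧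
    (¬ n ≡ 0 [MOD k + 1] → ¬ n ≡ 1 [MOD k + 1] →
      (Matrix.of fun i j : Fin n => ThreeStep.prefixGen x y (i.val + j.val) k).det = 0) := by
  rcases subsingleton_or_nontrivial R with hR | hR
  · exact ⟨fun _ _ => Subsingleton.elim _ _, fun _ _ _ => Subsingleton.elim _ _,
      fun _ _ => Subsingleton.elim _ _⟩
  have key := ThreeStep.neg_one_pow_mul_det_prefixGen x y n k
  have hchoose (m : ℕ) : m.choose 2 * 2 + m = m * m := by
    rw [Nat.choose_two_right, Nat.div_mul_cancel (Nat.even_mul_pred_self m).two_dvd]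
    rcases m with _ | m
    · simp
    · rw [Nat.add_sub_cancel]
      ring
  have hk := hchoose (k + 1)
  have hkk : Even ((k + 1) * k) := by
    rw [mul_comm]
    exact Nat.even_mul_succ_self k
  refine ⟨fun a ha => ?_, fun _ a ha => ?_, fun h₀ h₁ => ?_⟩
  · have ha' := hchoose (a + 1)
    have hn' := hchoose n
    subst ha
    rw [ThreeStep.det_remCoeff_orthoPoly_mul, show (k + 1) * a * k = (k + 1) * k * a by ring,
      (hkk.mul_right a).neg_one_pow, one_mul] at key
    -- The additive form of this identity also shows that the natural subtraction does not truncate.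
    have hexp : (k + 1) ^ 2 * (a + 1).choose 2 - (k + 1) * a
        = ((k + 1) * a).choose 2 + a * (k + 1).choose 2 := by
      apply Nat.sub_eq_of_eq_add
      nlinarith
    rw [key, hexp, pow_add]
    ring
  · have ha' := hchoose (a + 1)
    have hn' := hchoose n
    subst ha
    rw [ThreeStep.det_remCoeff_orthoPoly_mul_add_one,
      show ((k + 1) * a + 1) * k = (k + 1) * k * a + k by ring, pow_add,
      (hkk.mul_right a).neg_one_pow, one_mul] at key
    have hexp : (k + 1) ^ 2 * (a + 1).choose 2
        = ((k + 1) * a + 1).choose 2 + a * (k + 1).choose 2 := by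
      nlinarith
    have hsq : ((-1 : R) ^ k) * (-1) ^ k = 1 := by
      rw [← mul_pow, neg_one_mul, neg_neg, one_pow]
    rw [hexp, pow_add]
    generalize (Matrix.of fun i j : Fin ((k + 1) * a + 1) =>
      ThreeStep.prefixGen x y (i.val + j.val) k).det = D at key ⊢
    -- The sign (-1)^k on each side of `key` cancels, its square being 1.
    linear_combination (-1 : R) ^ k * key + ((-1) ^ (a * (k + 1).choose 2)
      * ((x * y) ^ ((k + 1) * a + 1).choose 2 * (x * y) ^ (a * (k + 1).choose 2)) - D) * hsq
  · have hr := Nat.mod_lt n (show 0 < k + 1 by omega)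
    have hdiv := Nat.div_add_mod n (k + 1)
    have hr₂ : 2 ≤ n % (k + 1) := by
      by_contra h
      rcases (show n % (k + 1) = 0 ∨ n % (k + 1) = 1 by omega) with h | h
      · exact h₀ (by rw [Nat.ModEq, h, Nat.zero_mod])
      · exact h₁ (by rw [Nat.ModEq, h, Nat.mod_eq_of_lt (by omega)])
    have hzero := ThreeStep.det_remCoeff_orthoPoly_eq_zero (x + y) (x * y) k (n / (k + 1))
      (n % (k + 1)) hr₂ (by omega)
    rw [hdiv] at hzero
    rw [hzero, mul_zero] at key
    exact ((isUnit_one.neg.pow (n * k)).mul_right_eq_zero).1 key
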